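/- For an integer $r \ge 1$, an $r$-graph is a finite hypergraph all of whose edges have exactly $r$ vertices. For an $r$-graph $F$ with at least one edge, let $\mathrm{ex}(n,F)$ be the maximum number of edges of an $r$-graph on $n$ vertices that does not contain $F$ as a (not necessarily induced) subgraph, and let $\pi(F) = \lim_{n\to\infty} \mathrm{ex}(n,F)/\binom{n}{r}$ be the Turán density of $F$. Let $$\gamma(r) = \max\{\pi(F) : F \text{ is an } r\text{-graph with exactly three edges}\}.$$ Then $\gamma(r) < 1/2$ for every positive odd integer $r$. -/

import Mathlib

open Filter Topology

/-- An `r`-uniform hypergraph with vertex set `V`: a finite set of edges, each of which is a set of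
exactly `r` vertices. -/
structure RGraph (V : Type*) (r : ℕ) where
  /-- the set of edges -/
  edges : Finset (Finset V)
  /-- every edge has exactly `r` vertices -/
  sized : (edges : Set (Finset V)).Sized r

namespace RGraph

/-- `G` contains `F` as a subgraph: some injection of the vertices of `F` into those of `G` sends
every edge of `F` to an edge of `G`. -/
def IsContained {V W : Type*} {r : ℕ} (F : RGraph V r) (G : RGraph W r) : Prop :=
  ∃ φ : V ↪ W, ∀ e ∈ F.edges, e.map φ ∈ G.edges

/-- `G` is `F`-free. -/
def Free {V W : Type*} {r : ℕ} (F : RGraph V r) (G : RGraph W r) : Prop :=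
  ¬ F.IsContained G

/-- The edge numbers of the `F`-free `r`-graphs on `n` vertices. -/
def freeSizes {V : Type*} {r : ℕ} (F : RGraph V r) (n : ℕ) : Set ℕ :=
  {m | ∃ G : RGraph (Fin n) r, F.Free G ∧ G.edges.card = m}

/-- The Turán number `ex(n, F)`: the maximum number of edges of an `F`-free `r`-graph on `n`
vertices. -/
noncomputable def turanNumber {V : Type*} {r : ℕ} (F : RGraph V r) (n : ℕ) : ℕ :=
  sSup (F.freeSizes n)

/-- The Turán density `π(F) = lim ex(n, F) / (n choose r)`. -/
noncomputable def turanDensity {V : Type*} {r : ℕ} (F : RGraph V r) : ℝ :=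
  limUnder atTop fun n : ℕ => (F.turanNumber n : ℝ) / (n.choose r : ℝ)

/-- The set of all `π(F)`, where `F` is an `r`-graph with exactly three edges (on any finite vertex
set). -/
def threeEdgeDensities (r : ℕ) : Set ℝ :=
  {x | ∃ (V : Type) (_ : Finite V) (F : RGraph V r), F.edges.card = 3 ∧ F.turanDensity = x}

/-- `γ(r)`: the largest Turán density of an `r`-graph with exactly three edges. -/
noncomputable def gamma (r : ℕ) : ℝ := sSup (threeEdgeDensities r)

/-! Well-definedness of the maximum in `turanNumber`, of the limit in `turanDensity` and of the
maximum in `gamma`. -/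

theorem bddAbove_freeSizes {V : Type*} {r : ℕ} (F : RGraph V r) (n : ℕ) :
    BddAbove (F.freeSizes n) := by
  refine ⟨n.choose r, ?_⟩
  rintro _ ⟨G, -, rfl⟩
  simpa using G.sized.card_le

theorem freeSizes_nonempty {V : Type*} {r : ℕ} (F : RGraph V r) (hF : F.edges.Nonempty) (n : ℕ) :
    (F.freeSizes n).Nonempty := by
  refine ⟨0, ⟨∅, by simp [Set.Sized]⟩, ?_, rfl⟩
  rintro ⟨φ, h⟩
  obtain ⟨e, he⟩ := hF
  simpa using h e he

/-- The maximum defining `ex(n, F)` is attained as soon as `F` has an edge. -/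
theorem isGreatest_turanNumber {V : Type*} {r : ℕ} (F : RGraph V r) (hF : F.edges.Nonempty)
    (n : ℕ) : IsGreatest (F.freeSizes n) (F.turanNumber n) :=
  ⟨Nat.sSup_mem (F.freeSizes_nonempty hF n) (F.bddAbove_freeSizes n),
    fun _ hm => le_csSup (F.bddAbove_freeSizes n) hm⟩

theorem card_le_turanNumber {V : Type*} {r : ℕ} (F : RGraph V r) {n : ℕ} (G : RGraph (Fin n) r)
    (hG : F.Free G) : G.edges.card ≤ F.turanNumber n :=
  le_csSup (F.bddAbove_freeSizes n) ⟨G, hG, rfl⟩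

theorem turanNumber_succ_mul_le {V : Type*} {r : ℕ} (F : RGraph V r) (hF : F.edges.Nonempty)
    (n : ℕ) : F.turanNumber (n + 1) * (n + 1 - r) ≤ (n + 1) * F.turanNumber n := by
  classical
  obtain ⟨G, hG, hcard⟩ := (F.isGreatest_turanNumber hF (n + 1)).1
  rw [← hcard]
  have hv : ∀ v : Fin (n + 1),
      (G.edges.filter fun e => v ∉ e).card ≤ F.turanNumber n := by
    intro v
    let H : RGraph (Fin n) r :=
      ⟨Finset.univ.filter fun t => t.map v.succAboveEmb ∈ G.edges, by
        intro t ht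
        have h := G.sized (Finset.mem_coe.2 (Finset.mem_filter.1 ht).2)
        simpa using h⟩
    have hH : F.Free H := by
      rintro ⟨φ, hφ⟩
      refine hG ⟨φ.trans v.succAboveEmb, fun e he => ?_⟩
      have := hφ e he
      simp only [H, Finset.mem_filter] at this
      rw [← Finset.map_map]
      exact this.2
    refine le_trans ?_ (F.card_le_turanNumber H hH)
    have hsub : (G.edges.filter fun e => v ∉ e) ⊆
        H.edges.image (fun t => t.map v.succAboveEmb) := by
      intro e he
      obtain ⟨he, hve⟩ := Finset.mem_filter.1 he
      have hmap : (Finset.univ.filter fun x => v.succAbove x ∈ e).map v.succAboveEmb = e := by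
        ext y
        simp only [Finset.mem_map, Finset.mem_filter, Finset.mem_univ, true_and,
          Fin.succAboveEmb_apply]
        constructor
        · rintro ⟨x, hx, rfl⟩
          exact hx
        · intro hy
          have hne : y ≠ v := fun h => hve (h ▸ hy)
          obtain ⟨x, rfl⟩ := Fin.exists_succAbove_eq hne
          exact ⟨x, hy, rfl⟩
      refine Finset.mem_image.2 ⟨_, ?_, hmap⟩
      simp only [H, Finset.mem_filter, Finset.mem_univ, true_and]
      rw [hmap]
      exact he
    exact (Finset.card_le_card hsub).trans Finset.card_image_le
  have hdc := Finset.card_nsmul_le_card_nsmul' (s := (Finset.univ : Finset (Fin (n + 1))))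
    (t := G.edges) (r := fun v e => v ∉ e) (m := F.turanNumber n) (n := n + 1 - r)
    (fun e he => by
      have h := G.sized (Finset.mem_coe.2 he)
      have h2 : Finset.bipartiteBelow (fun v e => v ∉ e) Finset.univ e = eᶜ := by
        ext v; simp [Finset.bipartiteBelow]
      rw [h2, Finset.card_compl, Fintype.card_fin, h]
      simp)
    (fun v _ => by simpa [Finset.bipartiteAbove] using hv v)
  simpa using hdc

/-- The limit defining the Turán density of an `r`-graph with at least one edge exists. -/
theorem tendsto_turanDensity {V : Type*} {r : ℕ} (F : RGraph V r) (hF : F.edges.Nonempty) :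
    Tendsto (fun n : ℕ => (F.turanNumber n : ℝ) / (n.choose r : ℝ)) atTop
      (𝓝 F.turanDensity) := by
  have hanti : AntitoneOn (fun n : ℕ => (F.turanNumber n : ℝ) / (n.choose r : ℝ))
      (Set.Ici r) := by
    apply antitoneOn_nat_Ici_of_succ_le
    intro n hn
    have h1 : (0 : ℝ) < (n.choose r : ℝ) := by exact_mod_cast Nat.choose_pos hn
    have h2 : (0 : ℝ) < ((n + 1).choose r : ℝ) := by
      exact_mod_cast Nat.choose_pos (hn.trans (Nat.le_succ n))
    rw [div_le_div_iff₀ h2 h1]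
    have hk : 0 < n + 1 - r := by omega
    have key : F.turanNumber (n + 1) * n.choose r ≤ F.turanNumber n * (n + 1).choose r := by
      have e1 := Nat.choose_mul_succ_eq n r
      have e2 := F.turanNumber_succ_mul_le hF n
      refine Nat.le_of_mul_le_mul_right (c := n + 1) ?_ (Nat.succ_pos n)
      calc F.turanNumber (n + 1) * n.choose r * (n + 1)
          = (F.turanNumber (n + 1) * (n + 1 - r)) * (n + 1).choose r := by
            rw [mul_assoc, e1]; ring
        _ ≤ ((n + 1) * F.turanNumber n) * (n + 1).choose r := Nat.mul_le_mul_right _ e2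
        _ = F.turanNumber n * (n + 1).choose r * (n + 1) := by ring
    exact_mod_cast key
  have hbdd : BddBelow ((fun n : ℕ => (F.turanNumber n : ℝ) / (n.choose r : ℝ)) '' Set.Ici r) :=
    ⟨0, by rintro _ ⟨n, -, rfl⟩; positivity⟩
  have h := Real.tendsto_atTop_csInf_of_antitoneOn_bddBelow_nat_Ici hanti hbdd
  rwa [turanDensity, h.limUnder_eq]

/-- Transfer of containment between `r`-graphs that agree up to isolated vertices. -/
theorem IsContained.of_injOn {V V' W : Type*} [Fintype V'] [Fintype W] {r : ℕ}
    {F : RGraph V r} {F' : RGraph V' r} {G : RGraph W r} (f : V → V') (U : Finset V)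
    (hU : ∀ e ∈ F.edges, e ⊆ U) (hf : Set.InjOn f U)
    (hF' : ∀ e' ∈ F'.edges, ∃ e ∈ F.edges, (e' : Set V') = f '' e)
    (hcard : Fintype.card V' ≤ Fintype.card W) (h : F.IsContained G) : F'.IsContained G := by
  classical
  obtain ⟨φ, hφ⟩ := h
  rcases U.eq_empty_or_nonempty with rfl | ⟨u₀, hu₀⟩
  · obtain ⟨ψ⟩ := Function.Embedding.nonempty_of_card_le hcard
    refine ⟨ψ, fun e' he' => ?_⟩
    obtain ⟨e, he, hee⟩ := hF' e' he'
    have h0 : e = ∅ := Finset.subset_empty.1 (hU e he)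
    subst h0
    have h1 : e' = ∅ := by
      rw [← Finset.coe_eq_empty, hee]; simp
    subst h1
    simpa using hφ _ he
  · have : Nonempty V := ⟨u₀⟩
    let g : V' → W := fun y => φ (Function.invFunOn f U y)
    have hg : ∀ u ∈ U, g (f u) = φ u := by
      intro u hu
      simp only [g]
      rw [hf.leftInvOn_invFunOn (Finset.mem_coe.2 hu)]
    have hginj : Set.InjOn g (U.image f : Finset V') := by
      intro a ha b hb hab
      obtain ⟨u, hu, rfl⟩ := Finset.mem_image.1 (Finset.mem_coe.1 ha)
      obtain ⟨v, hv, rfl⟩ := Finset.mem_image.1 (Finset.mem_coe.1 hb)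
      rw [hg u hu, hg v hv] at hab
      rw [φ.injective hab]
    obtain ⟨ι⟩ := Function.Embedding.nonempty_of_card_le hcard
    obtain ⟨t, ht1, ht2⟩ : ∃ t : Finset W, (U.image f).image g ⊆ t ∧ t.card = Fintype.card V' := by
      obtain ⟨t, h1, -, h3⟩ := Finset.exists_subsuperset_card_eq
        (Finset.subset_univ ((U.image f).image g)) (n := Fintype.card V')
        (Finset.card_image_le.trans (Finset.card_le_univ _)) (by simpa using hcard)
      exact ⟨t, h1, h3⟩
    obtain ⟨ψ, hψ⟩ := Finset.exists_equiv_extend_of_card_eq ht2.symm ht1 hginj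
    refine ⟨ψ.toEmbedding.trans (Function.Embedding.subtype _), fun e' he' => ?_⟩
    obtain ⟨e, he, hee⟩ := hF' e' he'
    have h2 : e'.map (ψ.toEmbedding.trans (Function.Embedding.subtype _)) = e.map φ := by
      have hee' : e' = e.image f := by
        rw [← Finset.coe_inj, hee, Finset.coe_image]
      rw [hee', Finset.map_eq_image, Finset.map_eq_image, Finset.image_image]
      refine Finset.image_congr fun u hu => ?_
      have huU : u ∈ U := hU e he hu
      have h3 := hψ (f u) (Finset.mem_image_of_mem f huU)
      simpa [hg u huU] using h3
    rw [h2]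
    exact hφ e he

/-- Up to isolated vertices, which do not change the density, an `r`-graph with three edges lives
on `3 * r` vertices. -/
theorem exists_fin_turanDensity_eq {V : Type*} [Finite V] {r : ℕ} (F : RGraph V r)
    (hF : F.edges.card = 3) :
    ∃ F' : RGraph (Fin (3 * r)) r, F'.edges.card = 3 ∧ F'.turanDensity = F.turanDensity := by
  classical
  have := Fintype.ofFinite V
  let U : Finset V := F.edges.biUnion id
  have hU : ∀ e ∈ F.edges, e ⊆ U := fun e he => Finset.subset_biUnion_of_mem id he
  have hUc : U.card ≤ (Finset.univ : Finset (Fin (3 * r))).card := by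
    have h := Finset.card_biUnion_le_card_mul F.edges id r
      (fun e he => (F.sized (Finset.mem_coe.2 he)).le)
    simpa [hF] using h
  obtain ⟨f, hf⟩ : ∃ f : V → Fin (3 * r), Set.InjOn f U := by
    rcases Nat.eq_zero_or_pos r with rfl | hr
    · exfalso
      have h : F.edges.card ≤ (Fintype.card V).choose 0 := F.sized.card_le
      simp [hF] at h
    · have : Nonempty (Fin (3 * r)) := ⟨⟨0, by omega⟩⟩
      obtain ⟨f, -, hf⟩ := U.finite_toSet.exists_injOn_of_encard_le
        (t := ((Finset.univ : Finset (Fin (3 * r))) : Set (Fin (3 * r))))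
        (by rw [Set.encard_coe_eq_coe_finsetCard, Set.encard_coe_eq_coe_finsetCard]
            exact_mod_cast hUc)
      exact ⟨f, hf⟩
  have hinj : Set.InjOn (fun e : Finset V => e.image f) F.edges := by
    intro a ha b hb hab
    have hab' : f '' (a : Set V) = f '' (b : Set V) := by
      rw [← Finset.coe_image, ← Finset.coe_image]
      exact congrArg _ hab
    exact Finset.coe_injective
      ((hf.image_eq_image_iff (Finset.coe_subset.2 (hU a ha)) (Finset.coe_subset.2 (hU b hb))).1
        hab')
  let F' : RGraph (Fin (3 * r)) r := ⟨F.edges.image fun e => e.image f, by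
    intro e' he'
    obtain ⟨e, he, rfl⟩ := Finset.mem_image.1 (Finset.mem_coe.1 he')
    rw [Finset.card_image_of_injOn (hf.mono (Finset.coe_subset.2 (hU e he)))]
    exact F.sized (Finset.mem_coe.2 he)⟩
  have hF'3 : F'.edges.card = 3 := by
    exact (Finset.card_image_of_injOn hinj).trans hF
  have hne : F.edges.Nonempty := Finset.card_pos.1 (by omega)
  have hne' : F'.edges.Nonempty := Finset.card_pos.1 (by omega)
  have hV : Nonempty V := by
    by_contra h
    rw [not_nonempty_iff] at h
    have h1 : F.edges.card ≤ (Finset.univ : Finset (Finset V)).card := Finset.card_le_univ _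
    simp [hF] at h1
  refine ⟨F', hF'3, tendsto_nhds_unique (F'.tendsto_turanDensity hne') ?_⟩
  refine (F.tendsto_turanDensity hne).congr' ?_
  filter_upwards [eventually_ge_atTop (max (3 * r) (Fintype.card V))] with n hn
  have hiff : ∀ G : RGraph (Fin n) r, F.IsContained G ↔ F'.IsContained G := by
    intro G
    constructor
    · refine IsContained.of_injOn f U hU hf (fun e' he' => ?_)
        (by simpa using (le_max_left _ _).trans hn)
      obtain ⟨e, he, rfl⟩ := Finset.mem_image.1 he'
      exact ⟨e, he, Finset.coe_image⟩
    · refine IsContained.of_injOn (Function.invFunOn f U) (U.image f) (fun e' he' => ?_) ?_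
        (fun e he => ?_) (by simpa using (le_max_right _ _).trans hn)
      · obtain ⟨e, he, rfl⟩ := Finset.mem_image.1 he'
        exact Finset.image_subset_image (hU e he)
      · rw [Finset.coe_image]
        exact Function.invFunOn_injOn_image f U
      · refine ⟨e.image f, Finset.mem_image_of_mem _ he, ?_⟩
        rw [Finset.coe_image]
        exact (hf.invFunOn_image (Finset.coe_subset.2 (hU e he))).symm
  have hsz : F.freeSizes n = F'.freeSizes n := by
    simp only [freeSizes, Free, hiff]
  simp only [turanNumber, hsz]

/-- The maximum defining `γ(r)` is attained for every `r ≥ 1`. -/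
theorem isGreatest_gamma {r : ℕ} (hr : 1 ≤ r) :
    IsGreatest (threeEdgeDensities r) (gamma r) := by
  classical
  have hfin : (threeEdgeDensities r).Finite := by
    have : Finite (RGraph (Fin (3 * r)) r) :=
      Finite.of_injective (fun F => F.edges) fun F F' h => by
        cases F; cases F'; cases h; rfl
    refine (Set.finite_range fun F : RGraph (Fin (3 * r)) r => F.turanDensity).subset ?_
    rintro _ ⟨V, _, F, hF, rfl⟩
    obtain ⟨F', -, h⟩ := F.exists_fin_turanDensity_eq hF
    exact ⟨F', h⟩
  have hne : (threeEdgeDensities r).Nonempty := by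
    have hc : 3 ≤ (Finset.powersetCard r (Finset.univ : Finset (Fin (r + 2)))).card := by
      rw [Finset.card_powersetCard, Finset.card_univ, Fintype.card_fin, Nat.choose_symm_add,
        Nat.choose_two_right]
      refine (Nat.le_div_iff_mul_le two_pos).2 ?_
      calc 3 * 2 ≤ (r + 2) * (r + 1) := by nlinarith
        _ = (r + 2) * (r + 2 - 1) := by simp
    obtain ⟨E, hE, hE3⟩ := Finset.exists_subset_card_eq hc
    exact ⟨_, Fin (r + 2), inferInstance,
      ⟨E, fun e he => (Finset.mem_powersetCard.1 (hE (Finset.mem_coe.1 he))).2⟩, hE3, rfl⟩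
  exact ⟨hne.csSup_mem hfin, fun x hx => le_csSup hfin.bddAbove hx⟩

end RGraph

/-!
Let `F` have edges `A`, `B`, `C` and let `G` be an `F`-free `r`-graph on `n` vertices whose edge
density is close to `π(F) = p`. Adjoin one vertex `none` to `V` and map `Option V` to the vertices
of `G` uniformly at random. Each of `A`, `B`, `C` becomes an edge with probability about `p`, each
pair of them with probability at least about `p ^ 2` (conditioned on the common vertices the two
events are independent and equally likely, `sq_expect_imageInd_le`), and all three with probability
at most `o(1)`, the probability of a collision. By inclusion-exclusion the probability that an odd
number of them become edges is at most `3p(1 - 2p) + o(1)`; the same holds for every relabelling of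
`A`, `B`, `C` by a permutation of `Option V`. If `p ≥ 1/2`, then with probability `1 - o(1)` every
relabelled copy meets the pulled-back hypergraph in an even number of edges.

For odd `r` this parity condition forces the pulled-back hypergraph to be complete or empty
(`EvenOnCopies.iff_of_card_eq`). If some vertex is in one edge only, say `A`, moving it to `none`
does not affect `B` and `C`, so membership is invariant under exchanging a single vertex. Otherwise every vertex is
in two or three of the edges, and `3 * r` being odd gives a vertex `v` in all three. Comparing with
the relabelling that swaps `v` with a vertex of `A` and `B` only shows that moving `v` changes the
status of `A` if and only if it changes that of `B`, and likewise for `B` and `C`; as an even number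
of the three change, none does. Hence, up to probability `o(1)`,
`A` and `B` become edges together. But with probability at least about `p ^ 2 > 0` both `A` and `C`
become edges, and then `B` almost never does: a contradiction. The error terms are kept in
`RGraph.Free.sq_expect_imageInd_sub_le`, whose limit is `p ^ 2 ≤ K * 3p(1 - 2p)`.
-/

open scoped BigOperators

/-! ### Permutations and finite sets -/

/-- Of two finite sets of the same size, one is mapped onto the other by a permutation that fixes their
intersection pointwise. -/
theorem Finset.exists_perm_image_eq {ι : Type*} [Fintype ι] [DecidableEq ι] {A B : Finset ι}
    (h : A.card = B.card) :
    ∃ σ : Equiv.Perm ι, (∀ i ∈ A ∩ B, σ i = i) ∧ A.image σ = B := by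
  obtain ⟨g, hg⟩ := Finset.exists_equiv_extend_of_card_eq (α := A) (t := B)
    (by simpa using h) (s := Finset.univ.filter fun i : A => (i : ι) ∈ B)
    (f := Subtype.val) (by intro i; simp +contextual) Subtype.val_injective.injOn
  refine ⟨g.extendSubtype, fun i hi => ?_, ?_⟩
  · have hi' := Finset.mem_inter.1 hi
    rw [g.extendSubtype_apply_of_mem i hi'.1]
    exact hg ⟨i, hi'.1⟩ (by simp [hi'.2])
  · refine Finset.eq_of_subset_of_card_le (fun j hj => ?_) ?_
    · obtain ⟨i, hi, rfl⟩ := Finset.mem_image.1 hj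
      exact g.extendSubtype_mem i hi
    · rw [Finset.card_image_of_injective _ (Equiv.injective _), h]

theorem Finset.image_swap_of_mem {ι : Type*} [DecidableEq ι] {A : Finset ι} {a b : ι}
    (ha : a ∈ A) (hb : b ∈ A) : A.image (Equiv.swap a b) = A := by
  refine Finset.eq_of_subset_of_card_le (fun j hj => ?_)
    (Finset.card_image_of_injective _ (Equiv.injective _)).ge
  obtain ⟨i, hi, rfl⟩ := Finset.mem_image.1 hj
  rw [Equiv.swap_apply_def]
  split_ifs <;> assumption

theorem Finset.image_swap_of_notMem {ι : Type*} [DecidableEq ι] {A : Finset ι} {a b : ι}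
    (ha : a ∉ A) (hb : b ∉ A) : A.image (Equiv.swap a b) = A := by
  refine (Finset.image_congr fun i hi => ?_).trans Finset.image_id
  exact Equiv.swap_apply_of_ne_of_ne (fun h => ha (h ▸ hi)) (fun h => hb (h ▸ hi))

theorem Finset.image_perm_mul {ι : Type*} [DecidableEq ι] (A : Finset ι) (π σ : Equiv.Perm ι) :
    A.image (π * σ) = (A.image σ).image π := by
  rw [Finset.image_image, Equiv.Perm.coe_mul]

/-- A property of sets that survives one exchange of an element of `A` for an outer element, in
every relabelling, is shared by all images of `A`: that transposition and the setwise stabiliser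
of `A` generate the symmetric group. -/
theorem Finset.iff_image_perm_of_swap {ι : Type*} [Finite ι] [DecidableEq ι] {A : Finset ι}
    {v o : ι} (hv : v ∈ A) (ho : o ∉ A) {h : Finset ι → Prop}
    (hs : ∀ π : Equiv.Perm ι, h (A.image (π * Equiv.swap v o)) ↔ h (A.image π))
    (σ : Equiv.Perm ι) : h (A.image σ) ↔ h A := by
  have cross : ∀ (π : Equiv.Perm ι) (a b : ι), a ∈ A → b ∉ A →
      (h (A.image (π * Equiv.swap a b)) ↔ h (A.image π)) := by
    intro π a b ha hb
    -- `τ` stabilises `A` and conjugates `swap v o` to `swap a b`.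
    let τ : Equiv.Perm ι := Equiv.swap v a * Equiv.swap o b
    have hτ : A.image τ = A := by
      rw [Finset.image_perm_mul, Finset.image_swap_of_notMem ho hb, Finset.image_swap_of_mem hv ha]
    have hτ' : A.image (τ⁻¹ : Equiv.Perm ι) = A := by
      conv_lhs => rw [← hτ]
      rw [← Finset.image_perm_mul]
      simp
    have hτv : τ v = a := by
      have h1 : v ≠ o := fun e => ho (e ▸ hv)
      have h2 : v ≠ b := fun e => hb (e ▸ hv)
      simp [τ, Equiv.swap_apply_of_ne_of_ne h1 h2]
    have hτo : τ o = b := by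
      have h1 : b ≠ v := fun e => hb (e ▸ hv)
      have h2 : b ≠ a := fun e => hb (e ▸ ha)
      simp [τ, Equiv.swap_apply_of_ne_of_ne h1 h2]
    have hconj : Equiv.swap a b = τ * Equiv.swap v o * τ⁻¹ := by
      rw [← hτv, ← hτo, Equiv.swap_apply_apply]
    rw [hconj, ← mul_assoc, ← mul_assoc, Finset.image_perm_mul, hτ', hs (π * τ),
      Finset.image_perm_mul, hτ]
  induction σ using Equiv.Perm.swap_induction_on' with
  | one => simp
  | mul_swap π a b _ ih =>
    refine Iff.trans ?_ ih
    by_cases ha : a ∈ A <;> by_cases hb : b ∈ A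
    · rw [Finset.image_perm_mul, Finset.image_swap_of_mem ha hb]
    · exact cross π a b ha hb
    · rw [Equiv.swap_comm]
      exact cross π b a hb ha
    · rw [Finset.image_perm_mul, Finset.image_swap_of_notMem ha hb]

/-! ### Hypergraphs with even intersection with every copy of a three-edge hypergraph -/

/-- Three sets of odd size `r`, with every vertex of `A ∪ B ∪ C` in at least two of them,
have a common vertex; otherwise `3 * r` would be twice the number of vertices. -/
theorem exists_mem_inter_of_odd {ι : Type*} [DecidableEq ι] {A B C : Finset ι} {r : ℕ}
    (hr : Odd r) (hA : A.card = r) (hB : B.card = r) (hC : C.card = r)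
    (h1 : ∀ v ∈ A, v ∈ B ∨ v ∈ C) (h2 : ∀ v ∈ B, v ∈ A ∨ v ∈ C) (h3 : ∀ v ∈ C, v ∈ A ∨ v ∈ B) :
    ∃ v ∈ A, v ∈ B ∧ v ∈ C := by
  by_contra! hcon
  have hCeq : C = (A \ B) ∪ (B \ A) := by
    ext v
    simp only [Finset.mem_union, Finset.mem_sdiff]
    have := h1 v; have := h2 v; have := h3 v; have := hcon v
    tauto
  have hdisj : Disjoint (A \ B) (B \ A) := by
    rw [Finset.disjoint_left]
    intro v hv hv'
    exact (Finset.mem_sdiff.1 hv').2 (Finset.mem_sdiff.1 hv).1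
  have hc := Finset.card_union_of_disjoint hdisj
  have ha := Finset.card_sdiff_add_card_inter A B
  have hb := Finset.card_sdiff_add_card_inter B A
  rw [Finset.inter_comm] at hb
  rw [← hCeq] at hc
  obtain ⟨k, hk⟩ := hr
  omega

/-- The property `h` holds for an even number of the images of `A`, `B`, `C` under every
permutation. -/
def EvenOnCopies {ι : Type*} [DecidableEq ι] (h : Finset ι → Prop) (A B C : Finset ι) : Prop :=
  ∀ π : Equiv.Perm ι, h (A.image π) ↔ (h (B.image π) ↔ ¬ h (C.image π))

theorem EvenOnCopies.rotate {ι : Type*} [DecidableEq ι] {h : Finset ι → Prop} {A B C : Finset ι}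
    (H : EvenOnCopies h A B C) : EvenOnCopies h B C A := by
  intro π
  have := H π
  tauto

/-- Moving a vertex that lies in `A` only changes neither `B` nor `C`. -/
theorem EvenOnCopies.iff_image_of_private {ι : Type*} [Finite ι] [DecidableEq ι]
    {h : Finset ι → Prop} {A B C : Finset ι} (H : EvenOnCopies h A B C) {v o : ι}
    (hoA : o ∉ A) (hoB : o ∉ B) (hoC : o ∉ C) (hvA : v ∈ A) (hvB : v ∉ B) (hvC : v ∉ C)
    (σ : Equiv.Perm ι) : h (A.image σ) ↔ h A := by
  refine Finset.iff_image_perm_of_swap hvA hoA (fun π => ?_) σ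
  have e1 := H π
  have e2 := H (π * Equiv.swap v o)
  rw [Finset.image_perm_mul B, Finset.image_swap_of_notMem hvB hoB,
    Finset.image_perm_mul C, Finset.image_swap_of_notMem hvC hoC] at e2
  tauto

/-- For a vertex `v` common to `A`, `B`, `C` and a vertex `w` of `A` and `B` only, swapping `v` and
`w` keeps `A` and `B` but takes `v` out of `C`. Hence exchanging `v` for `o` changes the status of
`A` exactly when it changes that of `B`. -/
theorem EvenOnCopies.swap_iff_swap {ι : Type*} [DecidableEq ι]
    {h : Finset ι → Prop} {A B C : Finset ι} (H : EvenOnCopies h A B C) {v w o : ι}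
    (hoC : o ∉ C) (hvA : v ∈ A) (hvB : v ∈ B)
    (hwA : w ∈ A) (hwB : w ∈ B) (hwC : w ∉ C) (how : o ≠ w) (hov : o ≠ v) (π : Equiv.Perm ι) :
    (h (A.image (π * Equiv.swap v o)) ↔ h (A.image π)) ↔
      (h (B.image (π * Equiv.swap v o)) ↔ h (B.image π)) := by
  have e1 := H (π * Equiv.swap v w)
  have e2 := H (π * Equiv.swap v o * Equiv.swap v w)
  have hC : C.image (π * Equiv.swap v o * Equiv.swap v w) = C.image (π * Equiv.swap v w) := by
    rw [mul_assoc, Finset.image_perm_mul, Finset.image_perm_mul _ π]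
    congr 1
    rw [Finset.image_perm_mul]
    refine Finset.image_swap_of_notMem ?_ ?_
    · simp only [Finset.mem_image, not_exists, not_and]
      intro x hx hxv
      rw [Equiv.swap_apply_eq_iff, Equiv.swap_apply_left] at hxv
      exact hwC (hxv ▸ hx)
    · simp only [Finset.mem_image, not_exists, not_and]
      intro x hx hxv
      rw [Equiv.swap_apply_eq_iff, Equiv.swap_apply_of_ne_of_ne hov how] at hxv
      exact hoC (hxv ▸ hx)
  rw [hC] at e2
  rw [Finset.image_perm_mul A _ (Equiv.swap v w), Finset.image_perm_mul B _ (Equiv.swap v w),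
    Finset.image_swap_of_mem hvA hwA, Finset.image_swap_of_mem hvB hwB] at e1 e2
  tauto

/-- For odd `r`, an `r`-graph (here the property `h`) that meets every copy of `{A, B, C}` in an
even number of edges is complete or empty, as long as one vertex `o` lies outside `A ∪ B ∪ C`. -/
theorem EvenOnCopies.iff_of_card_eq {ι : Type*} [Fintype ι] [DecidableEq ι] {r : ℕ} (hr : Odd r)
    {h : Finset ι → Prop} {A B C : Finset ι} (H : EvenOnCopies h A B C)
    (hA : A.card = r) (hB : B.card = r) (hC : C.card = r) (hAC : A ≠ C)
    (hBA : B ≠ A) {o : ι} (hoA : o ∉ A) (hoB : o ∉ B) (hoC : o ∉ C) {S T : Finset ι}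
    (hS : S.card = r) (hT : T.card = r) : h S ↔ h T := by
  have key : ∀ A' : Finset ι, A'.card = r → (∀ σ : Equiv.Perm ι, h (A'.image σ) ↔ h A') →
      (h S ↔ h T) := by
    intro A' hA' hinv
    obtain ⟨σ, -, rfl⟩ := Finset.exists_perm_image_eq (hA'.trans hS.symm)
    obtain ⟨τ, -, rfl⟩ := Finset.exists_perm_image_eq (hA'.trans hT.symm)
    rw [hinv, hinv]
  by_cases h1 : ∀ v ∈ A, v ∈ B ∨ v ∈ C
  swap
  · push Not at h1
    obtain ⟨v, hv, hvB, hvC⟩ := h1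
    exact key A hA (H.iff_image_of_private hoA hoB hoC hv hvB hvC)
  by_cases h2 : ∀ v ∈ B, v ∈ A ∨ v ∈ C
  swap
  · push Not at h2
    obtain ⟨v, hv, hvA, hvC⟩ := h2
    exact key B hB (H.rotate.iff_image_of_private hoB hoC hoA hv hvC hvA)
  by_cases h3 : ∀ v ∈ C, v ∈ A ∨ v ∈ B
  swap
  · push Not at h3
    obtain ⟨v, hv, hvA, hvB⟩ := h3
    exact key C hC (H.rotate.rotate.iff_image_of_private hoC hoA hoB hv hvA hvB)
  obtain ⟨v, hvA, hvB, hvC⟩ := exists_mem_inter_of_odd hr hA hB hC h1 h2 h3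
  obtain ⟨w, hwA, hwC⟩ : ∃ w ∈ A, w ∉ C := by
    by_contra! hsub
    exact hAC (Finset.eq_of_subset_of_card_le hsub (hC.trans hA.symm).le)
  obtain ⟨u, huB, huA⟩ : ∃ u ∈ B, u ∉ A := by
    by_contra! hsub
    exact hBA (Finset.eq_of_subset_of_card_le hsub (hA.trans hB.symm).le)
  have hwB : w ∈ B := (h1 w hwA).resolve_right hwC
  have huC : u ∈ C := (h2 u huB).resolve_left huA
  refine key A hA (Finset.iff_image_perm_of_swap hvA hoA fun π => ?_)
  have hov : o ≠ v := fun e => hoA (e ▸ hvA)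
  have c1 := H.swap_iff_swap hoC hvA hvB hwA hwB hwC (fun e => hoA (e ▸ hwA)) hov π
  have c2 := H.rotate.swap_iff_swap hoA hvB hvC huB huC huA (fun e => hoB (e ▸ huB)) hov π
  -- The exchange changes the status of all three sets or of none; parity leaves only the latter.
  have e1 := H π
  have e2 := H (π * Equiv.swap v o)
  clear key h1 h2 h3 H
  grind

/-! ### Uniformly random functions -/

theorem expect_comp_perm {ι W : Type*} [Fintype ι] [DecidableEq ι] [Fintype W]
    (σ : Equiv.Perm ι) (f : (ι → W) → ℝ) : 𝔼 x : ι → W, f (x ∘ σ) = 𝔼 x : ι → W, f x :=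
  Fintype.expect_equiv (σ.symm.arrowCongr (Equiv.refl W)) _ _ fun _ => rfl

theorem expect_perm_comp {ι W : Type*} [Fintype ι] [DecidableEq ι] [Fintype W]
    (τ : Equiv.Perm W) (f : (ι → W) → ℝ) : 𝔼 x : ι → W, f (τ ∘ x) = 𝔼 x : ι → W, f x :=
  Fintype.expect_equiv ((Equiv.refl ι).arrowCongr τ) _ _ fun _ => rfl

/-- Splicing two independent uniformly random functions gives a uniformly random function: the map
`(x, y) ↦ (x on S and y off S, y on S and x off S)` is an involution. -/
theorem expect_piecewise {ι W : Type*} [Fintype ι] [DecidableEq ι] [Fintype W] [Nonempty W]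
    (S : Finset ι) (f : (ι → W) → ℝ) :
    𝔼 x : ι → W, 𝔼 y : ι → W, f (S.piecewise x y) = 𝔼 x : ι → W, f x := by
  have hinv : Function.Involutive fun p : (ι → W) × (ι → W) =>
      (S.piecewise p.1 p.2, S.piecewise p.2 p.1) := by
    rintro ⟨x, y⟩
    ext i <;> by_cases hi : i ∈ S <;> simp [hi]
  have h1 : 𝔼 p : (ι → W) × (ι → W), f (S.piecewise p.1 p.2)
      = 𝔼 p : (ι → W) × (ι → W), f p.1 :=
    Fintype.expect_equiv hinv.toPerm _ _ fun p => rfl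
  rw [← Finset.univ_product_univ, Finset.expect_product, Finset.expect_product] at h1
  simpa using h1

theorem sq_expect_le_expect_sq {α : Type*} [Fintype α] [Nonempty α] (f : α → ℝ) :
    (𝔼 x, f x) ^ 2 ≤ 𝔼 x, f x ^ 2 := by
  have h := Finset.expect_mul_sq_le_sq_mul_sq Finset.univ f (fun _ => 1)
  simpa using h

/-- Correlation inequality: a function of the coordinates in `A` is positively correlated with its
image under a permutation of the coordinates that fixes `S` pointwise and moves the rest of `A` off
`A`. Conditioned on the coordinates in `S`, both are independent with the same mean, so that this
is Jensen's inequality. -/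
theorem sq_expect_le_expect_mul_comp {ι W : Type*} [Fintype ι] [DecidableEq ι] [Fintype W]
    [Nonempty W] {A S : Finset ι} (σ : Equiv.Perm ι) {g : (ι → W) → ℝ}
    (hg : DependsOn g (A : Set ι)) (hσ : ∀ i ∈ S, σ i = i)
    (hσA : ∀ i ∈ A, σ i ∈ A → i ∈ S) :
    (𝔼 x : ι → W, g x) ^ 2 ≤ 𝔼 x : ι → W, g x * g (x ∘ σ) := by
  let M : (ι → W) → ℝ := fun x => 𝔼 y : ι → W, g (S.piecewise x y)
  -- resample the coordinates outside `A`
  have h1 : 𝔼 x : ι → W, g x * g (x ∘ σ) = 𝔼 x : ι → W, g x * M x := by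
    rw [← expect_piecewise A (fun x => g x * g (x ∘ σ))]
    refine Finset.expect_congr rfl fun x _ => ?_
    have e1 : ∀ y : ι → W, g (A.piecewise x y) = g x := fun y =>
      hg fun i hi => by simp [Finset.mem_coe.1 hi]
    simp only [e1]
    rw [← Finset.mul_expect]
    congr 1
    refine Eq.trans ?_ (expect_comp_perm σ fun y => g (S.piecewise x y))
    refine Finset.expect_congr rfl fun y _ => hg fun i hi => ?_
    have hi : i ∈ A := hi
    by_cases hS : i ∈ S
    · simp [hS, hσ i hS, hi]
    · have : σ i ∉ A := fun h => hS (hσA i hi h)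
      simp [hS, this]
  have hM : ∀ x y : ι → W, M (S.piecewise x y) = M x := fun x y => by
    refine Finset.expect_congr rfl fun z _ => congrArg g ?_
    ext i
    by_cases hi : i ∈ S <;> simp [hi]
  -- resample the coordinates outside `S`
  have h2 : 𝔼 x : ι → W, g x * M x = 𝔼 x : ι → W, M x ^ 2 := by
    rw [← expect_piecewise S (fun x => g x * M x)]
    refine Finset.expect_congr rfl fun x _ => ?_
    simp only [hM]
    rw [← Finset.expect_mul, sq]
  rw [h1, h2, ← expect_piecewise S g]
  exact sq_expect_le_expect_sq M

/-! ### Random images of edges -/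

/-- The indicator that `x` maps `A` onto an edge of `G`. If `A` has `r` elements, this forces `x` to
be injective on `A`. -/
noncomputable def RGraph.imageInd {ι W : Type*} {r : ℕ} (G : RGraph W r) (A : Finset ι)
    (x : ι → W) : ℝ :=
  open Classical in if A.image x ∈ G.edges then 1 else 0

/-- The probability that a uniformly random function `ι → W` is not injective. -/
noncomputable def collisionProb (ι W : Type*) [Fintype ι] [DecidableEq ι] [Fintype W] : ℝ :=
  open Classical in 𝔼 x : ι → W, if Function.Injective x then 0 else 1

/-- The probability that a uniformly random function `ι → W` is injective on `A`. -/
noncomputable def injOnProb {ι : Type*} (W : Type*) [Fintype ι] [DecidableEq ι] [Fintype W]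
    (A : Finset ι) : ℝ :=
  open Classical in 𝔼 x : ι → W, if (A.image x).card = A.card then 1 else 0

namespace RGraph

section

variable {ι W : Type*} {r : ℕ} (G : RGraph W r)

theorem imageInd_eq_zero_or_one (A : Finset ι) (x : ι → W) :
    G.imageInd A x = 0 ∨ G.imageInd A x = 1 := by
  unfold imageInd
  split_ifs <;> simp

theorem imageInd_comp_perm [DecidableEq ι] (A : Finset ι) (x : ι → W) (σ : Equiv.Perm ι) :
    G.imageInd A (x ∘ σ) = G.imageInd (A.image σ) x := by
  classical
  have : A.image (x ∘ σ) = (A.image σ).image x := Finset.image_image.symm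
  unfold imageInd
  congr!

theorem dependsOn_imageInd (A : Finset ι) : DependsOn (G.imageInd A) (A : Set ι) := by
  classical
  intro x y h
  have : A.image x = A.image y := Finset.image_congr h
  simp only [imageInd, this]

variable [Fintype ι] [DecidableEq ι] [Fintype W]

theorem expect_imageInd_eq {A B : Finset ι} (h : A.card = B.card) :
    𝔼 x : ι → W, G.imageInd A x = 𝔼 x : ι → W, G.imageInd B x := by
  obtain ⟨σ, -, rfl⟩ := Finset.exists_perm_image_eq h
  rw [← expect_comp_perm σ]
  simp only [imageInd_comp_perm]

theorem sq_expect_imageInd_le [Nonempty W] {A B : Finset ι} (h : A.card = B.card) :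
    (𝔼 x : ι → W, G.imageInd A x) ^ 2 ≤ 𝔼 x : ι → W, G.imageInd A x * G.imageInd B x := by
  obtain ⟨σ, hσ, rfl⟩ := Finset.exists_perm_image_eq h
  simp only [← imageInd_comp_perm]
  refine sq_expect_le_expect_mul_comp σ (G.dependsOn_imageInd A) hσ fun i hi hi' => ?_
  -- `σ` sends `σ i`, which lies in both sets, to itself.
  have h2 : σ i ∈ A ∩ A.image σ := Finset.mem_inter.2 ⟨hi', Finset.mem_image_of_mem σ hi⟩
  have h3 := σ.injective (hσ _ h2)
  rwa [h3] at h2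

theorem expect_image_eq [DecidableEq W] (A : Finset ι) {e e' : Finset W} (h : e.card = e'.card) :
    𝔼 x : ι → W, (if A.image x = e then (1 : ℝ) else 0)
      = 𝔼 x : ι → W, (if A.image x = e' then (1 : ℝ) else 0) := by
  obtain ⟨τ, -, rfl⟩ := Finset.exists_perm_image_eq h
  rw [← expect_perm_comp τ fun x => if A.image x = e.image τ then (1 : ℝ) else 0]
  refine Finset.expect_congr rfl fun x _ => ?_
  rw [← Finset.image_image]
  simp only [(Finset.image_injective τ.injective).eq_iff]

/-- All `r`-sets of `W` are equally likely to be the image of `A`. -/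
theorem expect_imageInd_eq_div {A : Finset ι} (hA : A.card = r) (hr : r ≤ Fintype.card W) :
    𝔼 x : ι → W, G.imageInd A x
      = G.edges.card / ((Fintype.card W).choose r : ℝ) * injOnProb W A := by
  classical
  obtain ⟨e₀, -, he₀⟩ := Finset.exists_subset_card_eq (s := (Finset.univ : Finset W)) (n := r)
    (by simpa using hr)
  have key : ∀ E : Finset (Finset W), (∀ e ∈ E, e.card = r) →
      𝔼 x : ι → W, (if A.image x ∈ E then (1 : ℝ) else 0)
        = E.card * 𝔼 x : ι → W, (if A.image x = e₀ then (1 : ℝ) else 0) := by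
    intro E hE
    have : ∀ x : ι → W, (if A.image x ∈ E then (1 : ℝ) else 0)
        = ∑ e ∈ E, if A.image x = e then (1 : ℝ) else 0 := fun x => by simp
    simp only [this]
    rw [Finset.expect_sum_comm,
      Finset.sum_congr rfl fun e he => expect_image_eq A ((hE e he).trans he₀.symm)]
    simp
  have h1 : 𝔼 x : ι → W, G.imageInd A x
      = G.edges.card * 𝔼 x : ι → W, (if A.image x = e₀ then (1 : ℝ) else 0) := by
    rw [← key G.edges fun e he => G.sized (Finset.mem_coe.2 he)]
    refine Finset.expect_congr rfl fun x _ => ?_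
    simp only [imageInd]
  have h2 : injOnProb W A = (Fintype.card W).choose r *
      𝔼 x : ι → W, (if A.image x = e₀ then (1 : ℝ) else 0) := by
    have := key (Finset.powersetCard r Finset.univ) fun e he => (Finset.mem_powersetCard.1 he).2
    rw [Finset.card_powersetCard, Finset.card_univ] at this
    rw [← this, injOnProb]
    refine Finset.expect_congr rfl fun x _ => ?_
    simp [Finset.mem_powersetCard, hA]
  have h3 : ((Fintype.card W).choose r : ℝ) ≠ 0 := by
    exact_mod_cast (Nat.choose_pos hr).ne'
  rw [h1, h2]
  field_simp

end

end RGraph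

theorem one_sub_collisionProb_le {ι W : Type*} [Fintype ι] [DecidableEq ι] [Fintype W] [Nonempty W]
    (A : Finset ι) : 1 - collisionProb ι W ≤ injOnProb W A := by
  classical
  have h : (1 : ℝ) = 𝔼 _x : ι → W, (1 : ℝ) := by simp
  rw [collisionProb, injOnProb, h, ← Finset.expect_sub_distrib]
  refine Finset.expect_le_expect fun x _ => ?_
  by_cases hx : Function.Injective x
  · simp [hx, Finset.card_image_of_injective]
  · simp only [hx, if_false]
    split_ifs <;> simp

theorem injOnProb_le_one {ι W : Type*} [Fintype ι] [DecidableEq ι] [Fintype W] [Nonempty W]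
    (A : Finset ι) : injOnProb W A ≤ 1 := by
  classical
  refine Finset.expect_le Finset.univ_nonempty fun x _ => ?_
  split_ifs <;> simp

theorem one_sub_collisionProb_eq {ι W : Type*} [Fintype ι] [DecidableEq ι] [Fintype W]
    [Nonempty W] : 1 - collisionProb ι W
      = ((Fintype.card W).descFactorial (Fintype.card ι) : ℝ)
        / (Fintype.card W : ℝ) ^ Fintype.card ι := by
  classical
  have h : (1 : ℝ) = 𝔼 _x : ι → W, (1 : ℝ) := by simp
  have h2 : Fintype.card {x : ι → W // Function.Injective x}
      = (Fintype.card W).descFactorial (Fintype.card ι) := by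
    rw [Fintype.card_congr (Equiv.subtypeInjectiveEquivEmbedding ι W), Fintype.card_embedding_eq]
  rw [collisionProb, h, ← Finset.expect_sub_distrib, Fintype.expect_eq_sum_div_card, ← h2,
    Fintype.card_fun, Fintype.card_subtype]
  push_cast
  congr 1
  rw [← Finset.sum_boole]
  refine Finset.sum_congr rfl fun x _ => ?_
  split_ifs <;> simp

theorem tendsto_collisionProb (ι : Type*) [Fintype ι] [DecidableEq ι] :
    Tendsto (fun n : ℕ => collisionProb ι (Fin n)) atTop (𝓝 0) := by
  have h1 : Tendsto (fun n : ℕ => (n.descFactorial (Fintype.card ι) : ℝ)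
      / (n : ℝ) ^ Fintype.card ι) atTop (𝓝 1) :=
    (Asymptotics.isEquivalent_iff_tendsto_one (by
      filter_upwards [eventually_gt_atTop 0] with n hn
      positivity)).1 (isEquivalent_descFactorial (Fintype.card ι))
  have h2 := h1.const_sub 1
  rw [sub_self] at h2
  refine h2.congr' ?_
  filter_upwards [eventually_gt_atTop 0] with n hn
  have : Nonempty (Fin n) := ⟨⟨0, hn⟩⟩
  have h3 := one_sub_collisionProb_eq (ι := ι) (W := Fin n)
  rw [Fintype.card_fin] at h3
  linarith

/-! ### The density inequality -/

namespace RGraph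

/-- `1` if an odd number of `A`, `B`, `C` is mapped to edges, else `0`. -/
noncomputable def oddInd {ι W : Type*} {r : ℕ} (G : RGraph W r) (A B C : Finset ι)
    (x : ι → W) : ℝ :=
  G.imageInd A x + G.imageInd B x + G.imageInd C x
    - 2 * (G.imageInd A x * G.imageInd B x + G.imageInd A x * G.imageInd C x
        + G.imageInd B x * G.imageInd C x)
    + 4 * (G.imageInd A x * G.imageInd B x * G.imageInd C x)

theorem oddInd_nonneg {ι W : Type*} {r : ℕ} (G : RGraph W r) (A B C : Finset ι) (x : ι → W) :
    0 ≤ G.oddInd A B C x := by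
  unfold oddInd
  rcases G.imageInd_eq_zero_or_one A x with ha | ha <;>
  rcases G.imageInd_eq_zero_or_one B x with hb | hb <;>
  rcases G.imageInd_eq_zero_or_one C x with hc | hc <;> rw [ha, hb, hc] <;> norm_num

/-- If no copy of `{A, B, C}` is met an odd number of times, the pullback of `G` under `x` is
complete or empty. -/
theorem imageInd_mul_one_sub_le {ι W : Type*} [Fintype ι] [DecidableEq ι] {r : ℕ} (hr : Odd r)
    (G : RGraph W r) {A B C : Finset ι} (hA : A.card = r) (hB : B.card = r) (hC : C.card = r)
    (hAC : A ≠ C) (hBA : B ≠ A) {o : ι} (hoA : o ∉ A) (hoB : o ∉ B) (hoC : o ∉ C) (x : ι → W) :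
    G.imageInd A x * (1 - G.imageInd B x)
      ≤ ∑ π : Equiv.Perm ι, G.oddInd (A.image π) (B.image π) (C.image π) x := by
  classical
  by_cases hex : ∃ π : Equiv.Perm ι, 1 ≤ G.oddInd (A.image π) (B.image π) (C.image π) x
  · obtain ⟨π, hπ⟩ := hex
    have h1 := Finset.single_le_sum
      (f := fun π : Equiv.Perm ι => G.oddInd (A.image π) (B.image π) (C.image π) x)
      (fun π _ => G.oddInd_nonneg _ _ _ x) (Finset.mem_univ π)
    refine le_trans ?_ (hπ.trans h1)
    rcases G.imageInd_eq_zero_or_one A x with ha | ha <;>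
    rcases G.imageInd_eq_zero_or_one B x with hb | hb <;> rw [ha, hb] <;> norm_num
  · push Not at hex
    have H : EvenOnCopies (fun S : Finset ι => S.image x ∈ G.edges) A B C := by
      intro π
      have := hex π
      unfold oddInd imageInd at this
      by_cases ha : (A.image π).image x ∈ G.edges <;>
      by_cases hb : (B.image π).image x ∈ G.edges <;>
      by_cases hc : (C.image π).image x ∈ G.edges <;>
      simp only [ha, hb, hc, if_true, if_false] at this ⊢ <;>
      first | (simp; done) | exact absurd this (by norm_num)
    have hAB := H.iff_of_card_eq hr hA hB hC hAC hBA hoA hoB hoC hA hB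
    have : G.imageInd A x * (1 - G.imageInd B x) = 0 := by
      unfold imageInd
      by_cases ha : A.image x ∈ G.edges
      · have hb := hAB.1 ha
        simp [ha, hb]
      · simp [ha]
    rw [this]
    exact Finset.sum_nonneg fun π _ => G.oddInd_nonneg _ _ _ x

theorem Free.expect_imageInd_mul_mul_le {V W : Type*} [Fintype V] [DecidableEq V] [Fintype W]
    {r : ℕ} {F : RGraph V r} {G : RGraph W r} (hFG : F.Free G) {A B C : Finset V}
    (hF : F.edges = {A, B, C}) (π : Equiv.Perm (Option V)) :
    𝔼 x : Option V → W, (G.imageInd ((A.image some).image π) x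
      * G.imageInd ((B.image some).image π) x * G.imageInd ((C.image some).image π) x)
      ≤ collisionProb (Option V) W := by
  classical
  refine Finset.expect_le_expect fun x _ => ?_
  by_cases hx : Function.Injective x
  · simp only [hx, if_true]
    by_contra! hpos
    refine hFG ⟨⟨fun v => x (π (some v)),
      hx.comp (π.injective.comp (Option.some_injective V))⟩, fun e he => ?_⟩
    have himg : e.map ⟨fun v => x (π (some v)),
        hx.comp (π.injective.comp (Option.some_injective V))⟩
        = ((e.image some).image π).image x := by
      rw [Finset.map_eq_image, Finset.image_image, Finset.image_image]
      rfl
    rw [himg]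
    by_contra hcon
    have h0 : G.imageInd ((e.image some).image π) x = 0 := by
      unfold imageInd
      exact if_neg hcon
    rw [hF] at he
    simp only [Finset.mem_insert, Finset.mem_singleton] at he
    rcases he with rfl | rfl | rfl <;> simp [h0] at hpos
  · simp only [hx, if_false]
    rcases G.imageInd_eq_zero_or_one ((A.image some).image π) x with ha | ha <;>
    rcases G.imageInd_eq_zero_or_one ((B.image some).image π) x with hb | hb <;>
    rcases G.imageInd_eq_zero_or_one ((C.image some).image π) x with hc | hc <;>
    rw [ha, hb, hc] <;> norm_num

/-- Let `d` be the homomorphism density of an edge in an `F`-free graph `G`. Pairs of edges of `F`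
have density at least `d ^ 2` and all three have almost none, so copies of `F` are rarely met in an
odd number of edges; on the other hand `A` is an edge and `B` is not with probability about
`d ^ 2` or more. -/
theorem Free.sq_expect_imageInd_sub_le {V W : Type*} [Fintype V] [DecidableEq V] [Fintype W]
    [Nonempty W] {r : ℕ} (hr : Odd r) {F : RGraph V r} {G : RGraph W r} (hFG : F.Free G)
    {A B C : Finset V} (hF : F.edges = {A, B, C}) (hAB : A ≠ B) (hAC : A ≠ C) :
    (𝔼 x : Option V → W, G.imageInd (A.image some) x) ^ 2 - collisionProb (Option V) W
      ≤ Fintype.card (Equiv.Perm (Option V)) *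
        (3 * (𝔼 x : Option V → W, G.imageInd (A.image some) x)
          - 6 * (𝔼 x : Option V → W, G.imageInd (A.image some) x) ^ 2
          + 4 * collisionProb (Option V) W) := by
  set d := 𝔼 x : Option V → W, G.imageInd (A.image some) x with hd
  set δ := collisionProb (Option V) W
  have hcard : ∀ e ∈ F.edges, (e.image (some : V → Option V)).card = r := fun e he => by
    rw [Finset.card_image_of_injective _ (Option.some_injective V)]
    exact F.sized (Finset.mem_coe.2 he)
  have hA := hcard A (by simp [hF])
  have hB := hcard B (by simp [hF])
  have hC := hcard C (by simp [hF])
  have hone : ∀ S : Finset (Option V), S.card = r → 𝔼 x : Option V → W, G.imageInd S x = d :=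
    fun S hS => G.expect_imageInd_eq (hS.trans hA.symm)
  have htwo : ∀ S T : Finset (Option V), S.card = r → T.card = r →
      d ^ 2 ≤ 𝔼 x : Option V → W, G.imageInd S x * G.imageInd T x := fun S T hS hT => by
    rw [← hone S hS]
    exact G.sq_expect_imageInd_le (hS.trans hT.symm)
  have hodd : ∀ π : Equiv.Perm (Option V), 𝔼 x : Option V → W, G.oddInd ((A.image some).image π)
      ((B.image some).image π) ((C.image some).image π) x ≤ 3 * d - 6 * d ^ 2 + 4 * δ := by
    intro π
    have hπ : ∀ S : Finset (Option V), S.card = r → (S.image π).card = r := fun S hS => by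
      rw [Finset.card_image_of_injective _ π.injective, hS]
    have h3 := hFG.expect_imageInd_mul_mul_le hF π
    have hAB := htwo _ _ (hπ _ hA) (hπ _ hB)
    have hAC := htwo _ _ (hπ _ hA) (hπ _ hC)
    have hBC := htwo _ _ (hπ _ hB) (hπ _ hC)
    have h1A := hone _ (hπ _ hA)
    have h1B := hone _ (hπ _ hB)
    have h1C := hone _ (hπ _ hC)
    simp only [oddInd, Finset.expect_add_distrib, Finset.expect_sub_distrib, ← Finset.mul_expect]
    linarith
  have hlow : d ^ 2 - δ
      ≤ 𝔼 x : Option V → W, G.imageInd (A.image some) x * (1 - G.imageInd (B.image some) x) := by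
    have h3 := hFG.expect_imageInd_mul_mul_le hF 1
    simp only [Equiv.Perm.coe_one, Finset.image_id] at h3
    have hAC := htwo _ _ hA hC
    -- `a * c ≤ a * (1 - b) + a * b * c` for indicators
    have hle : 𝔼 x : Option V → W, G.imageInd (A.image some) x * G.imageInd (C.image some) x
        ≤ 𝔼 x : Option V → W, (G.imageInd (A.image some) x * (1 - G.imageInd (B.image some) x)
          + G.imageInd (A.image some) x * G.imageInd (B.image some) x
            * G.imageInd (C.image some) x) := by
      refine Finset.expect_le_expect fun x _ => ?_
      rcases G.imageInd_eq_zero_or_one (A.image some) x with ha | ha <;>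
      rcases G.imageInd_eq_zero_or_one (B.image some) x with hb | hb <;>
      rcases G.imageInd_eq_zero_or_one (C.image some) x with hc | hc <;>
      rw [ha, hb, hc] <;> norm_num
    rw [Finset.expect_add_distrib] at hle
    linarith
  have hinj := Finset.image_injective (Option.some_injective V)
  have hup : 𝔼 x : Option V → W, G.imageInd (A.image some) x * (1 - G.imageInd (B.image some) x)
      ≤ ∑ _π : Equiv.Perm (Option V), (3 * d - 6 * d ^ 2 + 4 * δ) := by
    refine le_trans (Finset.expect_le_expect fun x _ =>
      G.imageInd_mul_one_sub_le hr hA hB hC (hinj.ne hAC) (hinj.ne hAB.symm) (o := none)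
        (by simp) (by simp) (by simp) x) ?_
    rw [Finset.expect_sum_comm]
    exact Finset.sum_le_sum fun π _ => hodd π
  rw [Finset.sum_const, Finset.card_univ, nsmul_eq_mul] at hup
  exact hlow.trans hup

theorem turanDensity_lt_half {V : Type*} [Finite V] {r : ℕ} (hr : Odd r) (F : RGraph V r)
    (hF : F.edges.card = 3) : F.turanDensity < 1 / 2 := by
  classical
  have := Fintype.ofFinite V
  obtain ⟨A, B, C, hAB, hAC, -, hFe⟩ := Finset.card_eq_three.1 hF
  have hne : F.edges.Nonempty := Finset.card_pos.1 (by omega)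
  set p := F.turanDensity
  let K : ℝ := ((Fintype.card (Equiv.Perm (Option V)) : ℕ) : ℝ)
  let δ : ℕ → ℝ := fun n => collisionProb (Option V) (Fin n)
  let d : ℕ → ℝ := fun n => (F.turanNumber n : ℝ) / (n.choose r : ℝ)
    * injOnProb (Fin n) (A.image (some : V → Option V))
  have hδ : Tendsto δ atTop (𝓝 0) := tendsto_collisionProb (Option V)
  have hq : Tendsto (fun n => injOnProb (Fin n) (A.image (some : V → Option V))) atTop (𝓝 1) := by
    refine tendsto_of_tendsto_of_tendsto_of_le_of_le' (g := fun n => 1 - δ n) (h := fun _ => 1)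
      (by simpa using hδ.const_sub 1) tendsto_const_nhds ?_ ?_ <;>
    · filter_upwards [eventually_gt_atTop 0] with n hn
      have : Nonempty (Fin n) := ⟨⟨0, hn⟩⟩
      first | exact one_sub_collisionProb_le _ | exact injOnProb_le_one _
  have hd : Tendsto d atTop (𝓝 p) := by
    simpa using (F.tendsto_turanDensity hne).mul hq
  have hle : ∀ᶠ n in atTop, d n ^ 2 - δ n ≤ K * (3 * d n - 6 * d n ^ 2 + 4 * δ n) := by
    filter_upwards [eventually_gt_atTop 0, eventually_ge_atTop r] with n hn hnr
    have : Nonempty (Fin n) := ⟨⟨0, hn⟩⟩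
    obtain ⟨G, hG, hcard⟩ := (F.isGreatest_turanNumber hne n).1
    have hA : (A.image (some : V → Option V)).card = r := by
      rw [Finset.card_image_of_injective _ (Option.some_injective V)]
      exact F.sized (Finset.mem_coe.2 (by simp [hFe]))
    have h1 := G.expect_imageInd_eq_div hA (by simpa using hnr)
    have h2 := hG.sq_expect_imageInd_sub_le hr hFe hAB hAC
    rw [h1, Fintype.card_fin, hcard] at h2
    exact h2
  have hlim : p ^ 2 - 0 ≤ K * (3 * p - 6 * p ^ 2 + 4 * 0) :=
    le_of_tendsto_of_tendsto ((hd.pow 2).sub hδ)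
      ((((hd.const_mul 3).sub ((hd.pow 2).const_mul 6)).add (hδ.const_mul 4)).const_mul K) hle
  by_contra! hp
  have hK : 0 ≤ K := Nat.cast_nonneg _
  have h1 : 3 * p - 6 * p ^ 2 + 4 * 0 ≤ 0 := by nlinarith
  have h2 := mul_nonpos_of_nonneg_of_nonpos hK h1
  nlinarith

end RGraph

theorem theorem1 (r : ℕ) (hr : Odd r) : RGraph.gamma r < 1 / 2 := by
  obtain ⟨V, _, F, hF, h⟩ := (RGraph.isGreatest_gamma hr.pos).1
  rw [← h]
  exact F.turanDensity_lt_half hr hF
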